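/- **Theorem (weak completeness).** Let $\mathrm{PR}$ be a countably infinite set of propositional variables and $\mathcal I$ an at most countable set of primitive types; an *index* is a finite nonempty subset $I\subseteq\mathcal I$. Formulas are given by $$\varphi ::= p \mid \neg\varphi \mid (\varphi\to\varphi)\mid \Box_i\varphi\mid \sqcap_I\varphi\mid \sqcup_I\varphi \qquad (p\in \mathrm{PR},\ i\in\mathcal I,\ I \text{ an index}),$$ with the other Boolean connectives as abbreviations. They are interpreted in Kripke models $M=(S,R,V)$ with $S\neq\emptyset$, $R_i\subseteq S\times S$ for $i\in\mathcal I$, and $V(p)\subseteq S$ for $p\in\mathrm{PR}$: variables and Boolean connectives as usual, and $\Box_i$, $\sqcap_I$, $\sqcup_I$ as the necessity operators of $R_i$, of $\bigcap_{i\in I}R_i$ and of the transitive closure of $\bigcup_{i\in I}R_i$, respectively. Let $L\in\{\mathrm K,\mathrm D,\mathrm T,\mathrm B,\mathrm{S4},\mathrm{S5}\}$. An $L$-model is a Kripke model in which every $R_i$ is, respectively, arbitrary; serial; reflexive; reflexive and symmetric; reflexive and transitive; an equivalence relation. The axiomatization $\mathbf{L}^{\sqcap\sqcup}$ consists of the following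 axiom schemes and rules, for all formulas $\varphi,\psi$, all $i\in\mathcal I$ and all indices $I,J$: * all instances of propositional tautologies, and modus ponens; * $\Box_i(\varphi\to\psi)\to(\Box_i\varphi\to\Box_i\psi)$, and from $\varphi$ infer $\Box_i\varphi$; * $\sqcap_I(\varphi\to\psi)\to(\sqcap_I\varphi\to\sqcap_I\psi)$, and from $\varphi$ infer $\sqcap_I\varphi$; $(\sqcap1)$ $\Box_i\varphi\leftrightarrow\sqcap_{\{i\}}\varphi$; $(\sqcap2)$ $\sqcap_I\varphi\to\sqcap_J\varphi$ if $I\subseteq J$; * $(\mathrm K\sqcup)$ $\sqcup_I(\varphi\to\psi)\to(\sqcup_I\varphi\to\sqcup_I\psi)$; $(\sqcup1)$ $\sqcup_I\varphi\to\Box_i(\varphi\wedge\sqcup_I\varphi)$ if $i\in I$; $(\sqcup2)$ from $\varphi\to\bigwedge_{i\in I}\Box_i(\varphi\wedge\psi)$ infer $\varphi\to\sqcup_I\psi$; * if $L=\mathrm D$: $\Box_i\varphi\to\neg\Box_i\neg\varphi$; * if $L\in\{\mathrm T,\mathrm B,\mathrm{S4},\mathrm{S5}\}$: $\Box_i\varphi\to\varphi$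 and $\sqcap_I\varphi\to\varphi$; * if $L=\mathrm B$: $\neg\varphi\to\Box_i\neg\Box_i\varphi$ and $\neg\varphi\to\sqcap_I\neg\sqcap_I\varphi$; * if $L=\mathrm{S4}$: $\Box_i\varphi\to\Box_i\Box_i\varphi$ and $\sqcap_I\varphi\to\sqcap_I\sqcap_I\varphi$; * if $L=\mathrm{S5}$: $\neg\Box_i\varphi\to\Box_i\neg\Box_i\varphi$ and $\neg\sqcap_I\varphi\to\sqcap_I\neg\sqcap_I\varphi$. Then $\mathbf{L}^{\sqcap\sqcup}$ is weakly complete: every formula that is true at every state of every $L$-model is provable in $\mathbf{L}^{\sqcap\sqcup}$. -/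

import Mathlib

universe u

namespace ModalIU

/-- An index: a finite nonempty set of primitive types. -/
abbrev Index (A : Type u) : Type u := {I : Finset A // I.Nonempty}

/-- The index consisting of a single primitive type. -/
def Index.single {A : Type u} (i : A) : Index A := ⟨{i}, Finset.singleton_nonempty i⟩

/-- Formulas over propositional variables `P` and primitive types `A`: boxes `□_i`,
intersection modalities `⊓_I` and transitive-closure-of-union modalities `⊔_I`. -/
inductive Form (P A : Type u) : Type u
  | var (p : P) : Form P A
  | neg (φ : Form P A) : Form P A
  | imp (φ ψ : Form P A) : Form P A
  | box (i : A) (φ : Form P A) : Form P A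
  | inter (I : Index A) (φ : Form P A) : Form P A
  | union (I : Index A) (φ : Form P A) : Form P A

namespace Form

variable {P A : Type u}

/-- Conjunction, as an abbreviation. -/
def conj (φ ψ : Form P A) : Form P A := neg (imp φ (neg ψ))

/-- Equivalence, as an abbreviation. -/
def iff (φ ψ : Form P A) : Form P A := conj (imp φ ψ) (imp ψ φ)

/-- Conjunction `f a ∧ (f b ∧ (… ∧ f z))` along the nonempty list `a, b, …, z`. -/
def conjList {X : Type u} (f : X → Form P A) : (l : List X) → l ≠ [] → Form P A
  | [], h => absurd rfl h
  | [x], _ => f x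
  | x :: y :: l, _ => conj (f x) (conjList f (y :: l) (List.cons_ne_nil y l))

/-- The conjunction of the formulas `f i` with `i ∈ I`, in a fixed enumeration of `I`. -/
noncomputable def conjIndex (I : Index A) (f : A → Form P A) : Form P A :=
  conjList f I.1.toList (fun h => I.2.ne_empty (Finset.toList_eq_nil.mp h))

/-- Propositional evaluation: variables and modal formulas are treated as propositional atoms
whose truth values are given by `v`. -/
def propEval (v : Form P A → Prop) : Form P A → Prop
  | neg φ => ¬ propEval v φ
  | imp φ ψ => propEval v φ → propEval v ψ
  | var p => v (var p)
  | box i φ => v (box i φ)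
  | inter I φ => v (inter I φ)
  | union I φ => v (union I φ)

/-- Instances of propositional tautologies. -/
def IsTautology (φ : Form P A) : Prop := ∀ v : Form P A → Prop, propEval v φ

end Form

/-- Kripke models over `P` and `A`. -/
structure Model (P A : Type u) where
  /-- states -/
  S : Type u
  nonempty : Nonempty S
  /-- accessibility relations -/
  R : A → S → S → Prop
  /-- valuation -/
  V : P → Set S

/-- Truth of a formula at a state of a model. -/
def Model.Sat {P A : Type u} (M : Model P A) : M.S → Form P A → Prop
  | s, .var p => s ∈ M.V p
  | s, .neg φ => ¬ M.Sat s φ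
  | s, .imp φ ψ => M.Sat s φ → M.Sat s ψ
  | s, .box i φ => ∀ t, M.R i s t → M.Sat t φ
  | s, .inter I φ => ∀ t, (∀ i ∈ I.1, M.R i s t) → M.Sat t φ
  | s, .union I φ =>
      ∀ t, Relation.TransGen (fun x y => ∃ i ∈ I.1, M.R i x y) s t → M.Sat t φ

/-- The six base logics. -/
inductive Logic
  | K | D | T | B | S4 | S5

/-- The frame condition of each logic on a single accessibility relation. -/
def Logic.FrameCond (L : Logic) {S : Type u} (r : S → S → Prop) : Prop :=
  match L with
  | .K => True
  | .D => ∀ s, ∃ t, r s t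
  | .T => ∀ s, r s s
  | .B => (∀ s, r s s) ∧ (∀ s t, r s t → r t s)
  | .S4 => (∀ s, r s s) ∧ (∀ s t w, r s t → r t w → r s w)
  | .S5 => Equivalence r

/-- Validity in the class of models belonging to the logic `L`. -/
def Valid {P A : Type u} (L : Logic) (φ : Form P A) : Prop :=
  ∀ M : Model P A, (∀ i, L.FrameCond (M.R i)) → ∀ s : M.S, M.Sat s φ

open Form in
/-- Provability in the axiomatization for `L` with intersection modalities and
transitive-closure-of-union modalities. -/
inductive Provable {P A : Type u} (L : Logic) : Form P A → Prop
  -- the minimal system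
  | pc (φ : Form P A) : IsTautology φ → Provable L φ
  | mp (φ ψ : Form P A) : Provable L (imp φ ψ) → Provable L φ → Provable L ψ
  | boxK (i : A) (φ ψ : Form P A) :
      Provable L (imp (box i (imp φ ψ)) (imp (box i φ) (box i ψ)))
  | boxN (i : A) (φ : Form P A) : Provable L φ → Provable L (box i φ)
  -- axioms of the particular logics for the boxes
  | boxD (i : A) (φ : Form P A) : L = .D →
      Provable L (imp (box i φ) (neg (box i (neg φ))))
  | boxT (i : A) (φ : Form P A) : (L = .T ∨ L = .B ∨ L = .S4 ∨ L = .S5) →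
      Provable L (imp (box i φ) φ)
  | boxB (i : A) (φ : Form P A) : L = .B →
      Provable L (imp (neg φ) (box i (neg (box i φ))))
  | box4 (i : A) (φ : Form P A) : L = .S4 →
      Provable L (imp (box i φ) (box i (box i φ)))
  | box5 (i : A) (φ : Form P A) : L = .S5 →
      Provable L (imp (neg (box i φ)) (box i (neg (box i φ))))
  -- characterization of intersection
  | interK (I : Index A) (φ ψ : Form P A) :
      Provable L (imp (inter I (imp φ ψ)) (imp (inter I φ) (inter I ψ)))
  | interN (I : Index A) (φ : Form P A) : Provable L φ → Provable L (inter I φ)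
  | inter1 (i : A) (φ : Form P A) :
      Provable L (iff (box i φ) (inter (Index.single i) φ))
  | inter2 (I J : Index A) (φ : Form P A) : I.1 ⊆ J.1 →
      Provable L (imp (inter I φ) (inter J φ))
  | interT (I : Index A) (φ : Form P A) : (L = .T ∨ L = .B ∨ L = .S4 ∨ L = .S5) →
      Provable L (imp (inter I φ) φ)
  | interB (I : Index A) (φ : Form P A) : L = .B →
      Provable L (imp (neg φ) (inter I (neg (inter I φ))))
  | inter4 (I : Index A) (φ : Form P A) : L = .S4 →
      Provable L (imp (inter I φ) (inter I (inter I φ)))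
  | inter5 (I : Index A) (φ : Form P A) : L = .S5 →
      Provable L (imp (neg (inter I φ)) (inter I (neg (inter I φ))))
  -- characterization of the transitive closure of union
  | unionK (I : Index A) (φ ψ : Form P A) :
      Provable L (imp (union I (imp φ ψ)) (imp (union I φ) (union I ψ)))
  | union1 (I : Index A) (i : A) (φ : Form P A) : i ∈ I.1 →
      Provable L (imp (union I φ) (box i (conj φ (union I φ))))
  | union2 (I : Index A) (φ ψ : Form P A) :
      Provable L (imp φ (conjIndex I (fun i => box i (conj φ ψ)))) →
      Provable L (imp φ (union I ψ))

end ModalIU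

namespace ModalIU

variable {P A : Type u} {L : Logic}

open Form

/-! ### Theories and maximal consistent sets -/

/-! Suppose a formula belongs to every maximal consistent set (MCS); then it is provable. It
therefore suffices to build, for a valid `φ` and any MCS, an `L`-model with a point labelled by that
MCS in which truth of subformulas of `φ` is membership in the label (`sat_iff`).

Two obstacles shape the construction. Transitive closure defeats compactness, so accessibility is
filtered through the finite set `F` of subformulas (`Step`). The set of MCSs all of whose reachable
points contain `φ` then depends only on membership in `F`, hence is defined by a formula, to which
the rule (⊔2) applies (`exists_transGen_step`).

Intersections are the other obstacle: separate `i`-links between two points could come from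
different steps, none of them a step for the whole index. Points therefore carry bookkeeping from
which the labels of the steps can be recovered. Without transitivity, one toggled index suffices
(`OneStepRel`). For S4 and S5, an integer flow on labelled edges replaces paths: differences of
flows add, which gives transitivity, and negative flow gives symmetry. No flow is decomposed into
paths; testing it against the indicator function of a formula shows that the formula is preserved
(`FlowRel.mem_of_mem`). -/

/-- A set of formulas containing all theorems of `L` and closed under modus ponens. -/
structure IsTheory (L : Logic) (T : Set (Form P A)) : Prop where
  thm : ∀ φ, Provable L φ → φ ∈ T
  mp : ∀ φ ψ, imp φ ψ ∈ T → φ ∈ T → ψ ∈ T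

lemma IsTheory.of_tautology {T : Set (Form P A)} (hT : IsTheory L T) {φ : Form P A}
    (h : IsTautology φ) : φ ∈ T :=
  hT.thm _ (.pc _ h)

/-- Maximal consistent sets: negation-complete consistent theories. -/
structure MCS (P A : Type u) (L : Logic) where
  carrier : Set (Form P A)
  isTheory : IsTheory L carrier
  neg_mem : ∀ φ, neg φ ∈ carrier ↔ φ ∉ carrier

namespace MCS

instance : Membership (Form P A) (MCS P A L) := ⟨fun Γ φ => φ ∈ Γ.carrier⟩

/-- **Lindenbaum's lemma**. -/
theorem exists_of_notMem {T : Set (Form P A)} (hT : IsTheory L T) {φ : Form P A} (hφ : φ ∉ T) :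
    ∃ Γ : MCS P A L, (∀ ψ ∈ T, ψ ∈ Γ) ∧ φ ∉ Γ := by
  obtain ⟨M, hTM, hM⟩ := zorn_subset_nonempty {T : Set (Form P A) | IsTheory L T ∧ φ ∉ T}
    (fun c hc hchain hne => by
      refine ⟨⋃₀ c, ⟨⟨fun ψ hψ => ?_, fun ψ χ h1 h2 => ?_⟩, ?_⟩, fun s hs =>
        Set.subset_sUnion_of_mem hs⟩
      · obtain ⟨s, hs⟩ := hne
        exact ⟨s, hs, (hc hs).1.thm _ hψ⟩
      · obtain ⟨s, hs, h1⟩ := h1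
        obtain ⟨t, ht, h2⟩ := h2
        rcases hchain.total hs ht with hst | hts
        · exact ⟨t, ht, (hc ht).1.mp _ _ (hst h1) h2⟩
        · exact ⟨s, hs, (hc hs).1.mp _ _ h1 (hts h2)⟩
      · rintro ⟨s, hs, h⟩
        exact (hc hs).2 h) T ⟨hT, hφ⟩
  obtain ⟨⟨hMT, hφM⟩, hmax⟩ := hM
  -- The theory generated by `M` and `ψ` is `{χ | ψ → χ ∈ M}`; if it omitted `φ`, maximality would
  -- put `ψ` in `M`.
  have key : ∀ ψ, ψ ∉ M → imp ψ φ ∈ M := by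
    intro ψ hψ
    by_contra hcon
    have hth : IsTheory L {χ | imp ψ χ ∈ M} := by
      refine ⟨fun χ hχ => ?_, fun χ ξ h1 h2 => ?_⟩
      · exact hMT.mp _ _ (hMT.of_tautology (fun v => by simp only [propEval]; tauto))
          (hMT.thm χ hχ)
      · exact hMT.mp _ _ (hMT.mp _ _ (hMT.of_tautology
          (fun v => by simp only [propEval]; tauto)) h1) h2
    have hle := hmax (y := {χ | imp ψ χ ∈ M}) ⟨hth, hcon⟩ (fun χ hχ =>
      hMT.mp _ _ (hMT.of_tautology (fun v => by simp only [propEval]; tauto)) hχ)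
    exact hψ (hle (hMT.of_tautology (φ := imp ψ ψ) (fun v => by simp only [propEval]; tauto)))
  refine ⟨⟨M, hMT, fun ψ => ⟨fun h1 h2 => hφM ?_, fun h => ?_⟩⟩, hTM, hφM⟩
  · exact hMT.mp _ _ (hMT.mp _ _ (hMT.of_tautology
      (fun v => by simp only [propEval]; tauto)) h1) h2
  · by_contra h'
    exact hφM (hMT.mp _ _ (hMT.mp _ _ (hMT.of_tautology
      (fun v => by simp only [propEval]; tauto)) (key _ h)) (key _ h'))

variable {Γ Δ : MCS P A L} {φ ψ : Form P A}

lemma mem_of_provable (Γ : MCS P A L) (h : Provable L φ) : φ ∈ Γ := Γ.isTheory.thm _ h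

lemma mem_neg : neg φ ∈ Γ ↔ φ ∉ Γ := Γ.neg_mem φ

lemma mem_imp : imp φ ψ ∈ Γ ↔ (φ ∈ Γ → ψ ∈ Γ) := by
  refine ⟨Γ.isTheory.mp _ _, fun h => ?_⟩
  by_cases hφ : φ ∈ Γ
  · exact Γ.isTheory.mp _ _ (Γ.isTheory.of_tautology
      (fun v => by simp only [propEval]; tauto)) (h hφ)
  · exact Γ.isTheory.mp _ _ (Γ.isTheory.of_tautology
      (fun v => by simp only [propEval]; tauto)) (mem_neg.2 hφ)

lemma mem_of_provable_imp (h : Provable L (imp φ ψ)) (hφ : φ ∈ Γ) : ψ ∈ Γ :=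
  mem_imp.1 (Γ.mem_of_provable h) hφ

lemma mem_conj : conj φ ψ ∈ Γ ↔ φ ∈ Γ ∧ ψ ∈ Γ := by
  simp only [conj, mem_neg, mem_imp]; tauto

lemma mem_iff : Form.iff φ ψ ∈ Γ ↔ (φ ∈ Γ ↔ ψ ∈ Γ) := by
  simp only [Form.iff, mem_conj, mem_imp]; tauto

lemma mem_conjList {X : Type u} (f : X → Form P A) :
    ∀ (l : List X) (h : l ≠ []), conjList f l h ∈ Γ ↔ ∀ x ∈ l, f x ∈ Γ
  | [], h => absurd rfl h
  | [x], _ => by simp [conjList]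
  | x :: y :: l, _ => by
    rw [conjList, mem_conj, mem_conjList f (y :: l), List.forall_mem_cons (a := x)]

lemma mem_conjIndex {I : Index A} {f : A → Form P A} :
    conjIndex I f ∈ Γ ↔ ∀ i ∈ I.1, f i ∈ Γ := by
  simp [conjIndex, mem_conjList]

/-- A formula belonging to all maximal consistent sets is provable. -/
theorem provable_of_forall_mem (h : ∀ Γ : MCS P A L, φ ∈ Γ) : Provable L φ := by
  by_contra hφ
  obtain ⟨Γ, -, hΓ⟩ := exists_of_notMem (L := L) (T := {ψ | Provable L ψ})
    ⟨fun _ => id, fun _ _ => .mp _ _⟩ hφ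
  exact hΓ (h Γ)

lemma provable_imp (h : ∀ Γ : MCS P A L, φ ∈ Γ → ψ ∈ Γ) : Provable L (imp φ ψ) :=
  provable_of_forall_mem fun Γ => mem_imp.2 (h Γ)

/-! ### Modal formulas in maximal consistent sets -/

lemma box_mem {i : A} : box i φ ∈ Γ ↔ inter (Index.single i) φ ∈ Γ :=
  mem_iff.1 (Γ.mem_of_provable (.inter1 i φ))

lemma inter_mono {I J : Index A} (hIJ : I.1 ⊆ J.1) (h : inter I φ ∈ Γ) : inter J φ ∈ Γ :=
  mem_of_provable_imp (.inter2 I J φ hIJ) h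

lemma inter_of_box {i : A} {J : Index A} (hi : i ∈ J.1) (h : box i φ ∈ Γ) : inter J φ ∈ Γ :=
  inter_mono (I := Index.single i) (by simpa [Index.single] using hi) (box_mem.1 h)

lemma inter_imp {J : Index A} (h : Provable L (imp φ ψ)) (hφ : inter J φ ∈ Γ) :
    inter J ψ ∈ Γ :=
  mem_imp.1 (mem_of_provable_imp (.interK J φ ψ) (Γ.mem_of_provable (.interN J _ h))) hφ

lemma inter_of_union {i : A} {I J : Index A} (hI : i ∈ I.1) (hJ : i ∈ J.1)
    (h : union I φ ∈ Γ) : inter J φ ∈ Γ ∧ inter J (union I φ) ∈ Γ := by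
  have h1 := inter_of_box hJ (mem_of_provable_imp (.union1 I i φ hI) h)
  exact ⟨inter_imp (provable_imp fun _ h => (mem_conj.1 h).1) h1,
    inter_imp (provable_imp fun _ h => (mem_conj.1 h).2) h1⟩

/-- The canonical accessibility relation of `⊓_J`. -/
def Canon (J : Index A) (Γ Δ : MCS P A L) : Prop := ∀ φ, inter J φ ∈ Γ → φ ∈ Δ

lemma exists_canon {J : Index A} (h : inter J φ ∉ Γ) : ∃ Δ, Canon J Γ Δ ∧ φ ∉ Δ :=
  exists_of_notMem (T := {χ | inter J χ ∈ Γ})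
    ⟨fun χ hχ => Γ.mem_of_provable (.interN J χ hχ), fun χ ξ h1 h2 =>
      mem_imp.1 (mem_of_provable_imp (.interK J χ ξ) h1) h2⟩ h

/-- The logics with reflexive accessibility relations. -/
def _root_.ModalIU.Logic.IsRefl (L : Logic) : Prop := L = .T ∨ L = .B ∨ L = .S4 ∨ L = .S5

/-- The logics with symmetric accessibility relations. -/
def _root_.ModalIU.Logic.IsSymm (L : Logic) : Prop := L = .B ∨ L = .S5

/-- The logics with transitive accessibility relations. -/
def _root_.ModalIU.Logic.IsTrans (L : Logic) : Prop := L = .S4 ∨ L = .S5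

lemma inter_refl {J : Index A} (hL : L.IsRefl) (h : inter J φ ∈ Γ) : φ ∈ Γ :=
  mem_of_provable_imp (.interT J φ hL) h

lemma inter_symm {J : Index A} (hL : L.IsSymm) (h : φ ∉ Γ) :
    inter J (neg (inter J φ)) ∈ Γ := by
  rcases hL with hL | hL
  · exact mem_of_provable_imp (.interB J φ hL) (mem_neg.2 h)
  · refine mem_of_provable_imp (.inter5 J φ hL) (mem_neg.2 fun h' => h ?_)
    exact inter_refl (by simp [Logic.IsRefl, hL]) h'

lemma Canon.symm {J : Index A} (hL : L.IsSymm) (h : Canon J Γ Δ) : Canon J Δ Γ := by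
  intro φ hφ
  by_contra hn
  exact mem_neg.1 (h _ (inter_symm hL hn)) hφ

lemma inter_trans {J : Index A} (hL : L.IsTrans) (h : inter J φ ∈ Γ) :
    inter J (inter J φ) ∈ Γ := by
  rcases hL with hL | hL
  · exact mem_of_provable_imp (.inter4 J φ hL) h
  -- Axiom 4 from 5: a canonical successor lacking `⊓_J φ` contains `⊓_J ¬⊓_J φ`, and symmetry
  -- carries `¬⊓_J φ` back to `Γ`.
  · by_contra hn
    have hS : L.IsSymm := .inr hL
    obtain ⟨Δ, hΔ, hφ⟩ := exists_canon hn
    have h5 := mem_of_provable_imp (.inter5 J φ hL) (mem_neg.2 hφ)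
    exact mem_neg.1 (hΔ.symm hS _ h5) h

/-! ### Definability of saturated sets of maximal consistent sets -/

/-- A set of maximal consistent sets that depends only on the membership of finitely many formulas
is defined by a formula. -/
theorem exists_defining_formula (φ₀ : Form P A) {F : Set (Form P A)} (hF : F.Finite) :
    ∀ X : Set (MCS P A L), (∀ Γ Δ : MCS P A L, (∀ φ ∈ F, φ ∈ Γ ↔ φ ∈ Δ) → Γ ∈ X → Δ ∈ X) →
      ∃ χ : Form P A, ∀ Γ : MCS P A L, χ ∈ Γ ↔ Γ ∈ X := by
  induction F, hF using Set.Finite.induction_on with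
  -- Here `X` is everything or nothing; `φ₀` only supplies a formula from which to form a tautology.
  | empty =>
    intro X hX
    by_cases hne : X.Nonempty
    · obtain ⟨Γ, hΓ⟩ := hne
      exact ⟨imp φ₀ φ₀, fun Δ => ⟨fun _ => hX Γ Δ (by simp) hΓ, fun _ => mem_imp.2 id⟩⟩
    · refine ⟨neg (imp φ₀ φ₀), fun Δ => ⟨fun h => absurd (mem_imp.2 id) (mem_neg.1 h), fun h => ?_⟩⟩
      exact absurd ⟨Δ, h⟩ hne
  | @insert σ F _ _ ih =>
    intro X hX
    -- Split `X` by membership of `σ`: `χ₁` and `χ₂` define the saturations under `F` of the two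
    -- parts.
    obtain ⟨χ₁, h₁⟩ := ih {Γ | ∃ Δ ∈ X, (∀ φ ∈ F, φ ∈ Γ ↔ φ ∈ Δ) ∧ σ ∈ Δ} (by
      rintro Γ Δ h ⟨Θ, hΘ, h1, h2⟩
      exact ⟨Θ, hΘ, fun φ hφ => (h φ hφ).symm.trans (h1 φ hφ), h2⟩)
    obtain ⟨χ₂, h₂⟩ := ih {Γ | ∃ Δ ∈ X, (∀ φ ∈ F, φ ∈ Γ ↔ φ ∈ Δ) ∧ σ ∉ Δ} (by
      rintro Γ Δ h ⟨Θ, hΘ, h1, h2⟩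
      exact ⟨Θ, hΘ, fun φ hφ => (h φ hφ).symm.trans (h1 φ hφ), h2⟩)
    refine ⟨conj (imp σ χ₁) (imp (neg σ) χ₂), fun Γ => ?_⟩
    simp only [mem_conj, mem_imp, mem_neg, h₁, h₂, Set.mem_ofPred_eq]
    by_cases hσ : σ ∈ Γ
    · simp only [hσ, true_imp_iff, not_true, false_imp_iff, and_true]
      refine ⟨?_, fun h => ⟨Γ, h, fun _ _ => Iff.rfl, hσ⟩⟩
      rintro ⟨Δ, hΔ, h1, h2⟩
      exact hX Δ Γ (Set.forall_mem_insert.2 ⟨by simp [h2, hσ], fun φ hφ => (h1 φ hφ).symm⟩) hΔ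
    · simp only [hσ, true_imp_iff, not_false_iff, false_imp_iff, true_and]
      refine ⟨?_, fun h => ⟨Γ, h, fun _ _ => Iff.rfl, hσ⟩⟩
      rintro ⟨Δ, hΔ, h1, h2⟩
      exact hX Δ Γ (Set.forall_mem_insert.2 ⟨by simp [h2, hσ], fun φ hφ => (h1 φ hφ).symm⟩) hΔ

/-! ### Filtered accessibility relations -/

/-- The set of subformulas of a formula. -/
def _root_.ModalIU.Form.subformulas : Form P A → Set (Form P A)
  | .var p => {.var p}
  | .neg φ => insert (.neg φ) φ.subformulas
  | .imp φ ψ => insert (.imp φ ψ) (φ.subformulas ∪ ψ.subformulas)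
  | .box i φ => insert (.box i φ) φ.subformulas
  | .inter I φ => insert (.inter I φ) φ.subformulas
  | .union I φ => insert (.union I φ) φ.subformulas

lemma _root_.ModalIU.Form.finite_subformulas (φ : Form P A) : φ.subformulas.Finite := by
  induction φ with
  | var p => exact Set.finite_singleton _
  | imp φ ψ h₁ h₂ => exact (h₁.union h₂).insert _
  | _ => simp only [Form.subformulas]; apply Set.Finite.insert; assumption

lemma _root_.ModalIU.Form.self_mem_subformulas (φ : Form P A) : φ ∈ φ.subformulas := by
  cases φ <;> simp [Form.subformulas]

/-- Truth of `⊓_J`-necessary formulas is passed on, as far as formulas in `F` can tell. -/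
def Passes (F : Set (Form P A)) (J : Index A) (Γ Δ : MCS P A L) : Prop :=
  ∀ φ ∈ F, ∀ ψ ∈ F, Provable L (imp φ (inter J ψ)) → φ ∈ Γ → ψ ∈ Δ

/-- The filtration through `F` of the canonical accessibility relation of `⊓_J`. -/
def Step (F : Set (Form P A)) (J : Index A) (Γ Δ : MCS P A L) : Prop :=
  Passes F J Γ Δ ∧ (L.IsSymm → Passes F J Δ Γ)

variable {F : Set (Form P A)}

lemma Canon.passes {J : Index A} (h : Canon J Γ Δ) : Passes F J Γ Δ :=
  fun _ _ _ _ hp hφ => h _ (mem_of_provable_imp hp hφ)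

lemma Canon.step {J : Index A} (h : Canon J Γ Δ) : Step F J Γ Δ :=
  ⟨h.passes, fun hL => (h.symm hL).passes⟩

lemma Step.symm {J : Index A} (hL : L.IsSymm) (h : Step F J Γ Δ) : Step F J Δ Γ :=
  ⟨h.2 hL, fun _ => h.1⟩

/-- Filtered steps see their source only through `F`, which makes sets described by reachability
definable. -/
lemma Step.congr_left {J : Index A} {Γ' : MCS P A L} (h : Step F J Γ Δ)
    (hΓ : ∀ φ ∈ F, φ ∈ Γ ↔ φ ∈ Γ') : Step F J Γ' Δ :=
  ⟨fun φ hφ ψ hψ hp hm => h.1 φ hφ ψ hψ hp ((hΓ φ hφ).2 hm),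
    fun hL φ hφ ψ hψ hp hm => (hΓ ψ hψ).1 (h.2 hL φ hφ ψ hψ hp hm)⟩

lemma Step.mem {J : Index A} (h : Step F J Γ Δ) (hφF : φ ∈ F) (hψF : ψ ∈ F)
    (hp : ∀ Θ : MCS P A L, φ ∈ Θ → inter J ψ ∈ Θ) (hφ : φ ∈ Γ) : ψ ∈ Δ :=
  h.1 φ hφF ψ hψF (provable_imp hp) hφ

/-- If `⊔_I ψ` fails, then some point reachable along filtered `I`-steps refutes `ψ`. -/
theorem exists_transGen_step (hF : F.Finite) {I : Index A} (h : union I φ ∉ Γ) :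
    ∃ Δ, Relation.TransGen (fun Γ Δ : MCS P A L => ∃ i ∈ I.1, Step F (Index.single i) Γ Δ) Γ Δ ∧
      φ ∉ Δ := by
  set r := fun Γ Δ : MCS P A L => ∃ i ∈ I.1, Step F (Index.single i) Γ Δ
  by_contra! hcon
  obtain ⟨χ, hχ⟩ := exists_defining_formula (L := L) φ hF
    {Γ | ∀ Δ, Relation.TransGen r Γ Δ → φ ∈ Δ} (by
      intro Γ Γ' hΓ hmem Δ hΔ
      refine hmem Δ ?_
      obtain ⟨Θ, ⟨i, hi, hs⟩, hΘ⟩ := Relation.TransGen.head'_iff.1 hΔ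
      exact Relation.TransGen.head'_iff.2
        ⟨Θ, ⟨i, hi, hs.congr_left fun φ hφ => (hΓ φ hφ).symm⟩, hΘ⟩)
  -- `χ` is an invariant for (⊔2): canonical successors are filtered steps, so they satisfy `φ` and
  -- inherit `χ`.
  have hp : Provable L (imp χ (conjIndex I fun i => box i (conj χ φ))) := by
    refine provable_imp fun Θ hΘ => mem_conjIndex.2 fun i hi => box_mem.2 ?_
    by_contra hn
    obtain ⟨Δ, hΔ, hn⟩ := exists_canon hn
    have hstep : r Θ Δ := ⟨i, hi, hΔ.step⟩
    rw [hχ] at hΘ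
    refine hn (mem_conj.2 ⟨(hχ Δ).2 fun Ξ hΞ => hΘ Ξ (.head hstep hΞ), hΘ Δ (.single hstep)⟩)
  exact h (mem_of_provable_imp (.union2 I χ φ hp) ((hχ Γ).2 hcon))

end MCS

/-! ### Models labelled by maximal consistent sets -/

open MCS

/-- A family of relations on a set whose points are labelled by maximal consistent sets, respecting
the modal formulas in `F` and realizing all filtered steps. -/
structure IsLabelling (F : Set (Form P A)) {S : Type u} (R : A → S → S → Prop)
    (π : S → MCS P A L) : Prop where
  inter_mem : ∀ (I : Index A) (φ : Form P A) (s t : S), φ ∈ F → inter I φ ∈ F →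
    (∀ i ∈ I.1, R i s t) → inter I φ ∈ π s → φ ∈ π t
  box_mem : ∀ (i : A) (φ : Form P A) (s t : S), φ ∈ F → box i φ ∈ F →
    R i s t → box i φ ∈ π s → φ ∈ π t
  union_mem : ∀ (I : Index A) (i : A) (φ : Form P A) (s t : S), φ ∈ F → union I φ ∈ F →
    i ∈ I.1 → R i s t → union I φ ∈ π s → φ ∈ π t ∧ union I φ ∈ π t
  exists_step : ∀ (s : S) (J : Index A) (Δ : MCS P A L), Step F J (π s) Δ →
    ∃ t, π t = Δ ∧ ∀ i ∈ J.1, R i s t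

namespace IsLabelling

/-- **Truth lemma** for labelled models. -/
theorem sat_iff {F : Set (Form P A)} (hF : F.Finite) {M : Model P A} {π : M.S → MCS P A L}
    (h : IsLabelling F M.R π) (hV : ∀ p s, s ∈ M.V p ↔ Form.var p ∈ π s) :
    ∀ φ : Form P A, φ.subformulas ⊆ F → ∀ s, M.Sat s φ ↔ φ ∈ π s := by
  intro φ
  induction φ with
  | var p => exact fun _ s => hV p s
  | neg φ ih =>
    intro hs s
    rw [Form.subformulas, Set.insert_subset_iff] at hs
    rw [Model.Sat, ih hs.2, mem_neg]
  | imp φ ψ ih₁ ih₂ =>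
    intro hs s
    rw [Form.subformulas, Set.insert_subset_iff, Set.union_subset_iff] at hs
    rw [Model.Sat, ih₁ hs.2.1, ih₂ hs.2.2, mem_imp]
  | box i φ ih =>
    intro hs s
    rw [Form.subformulas, Set.insert_subset_iff] at hs
    simp only [Model.Sat, ih hs.2]
    refine ⟨fun hsat => ?_, fun hm t ht =>
      h.box_mem i φ s t (hs.2 φ.self_mem_subformulas) hs.1 ht hm⟩
    by_contra hn
    obtain ⟨Δ, hΔ, hφ⟩ := exists_canon (fun hm => hn (MCS.box_mem.2 hm))
    obtain ⟨t, rfl, ht⟩ := h.exists_step s _ Δ hΔ.step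
    exact hφ (hsat t (ht i (Finset.mem_singleton_self i)))
  | inter I φ ih =>
    intro hs s
    rw [Form.subformulas, Set.insert_subset_iff] at hs
    simp only [Model.Sat, ih hs.2]
    refine ⟨fun hsat => ?_, fun hm t ht =>
      h.inter_mem I φ s t (hs.2 φ.self_mem_subformulas) hs.1 ht hm⟩
    by_contra hn
    obtain ⟨Δ, hΔ, hφ⟩ := exists_canon hn
    obtain ⟨t, rfl, ht⟩ := h.exists_step s _ Δ hΔ.step
    exact hφ (hsat t ht)
  | union I φ ih =>
    intro hs s
    rw [Form.subformulas, Set.insert_subset_iff] at hs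
    simp only [Model.Sat, ih hs.2]
    constructor
    · intro hsat
      by_contra hn
      obtain ⟨Δ, hΔ, hφ⟩ := exists_transGen_step hF hn
      have hlift : ∃ t, π t = Δ ∧ Relation.TransGen (fun x y => ∃ i ∈ I.1, M.R i x y) s t := by
        clear hφ
        induction hΔ with
        | single hstep =>
          obtain ⟨i, hi, hstep⟩ := hstep
          obtain ⟨t, rfl, ht⟩ := h.exists_step s _ _ hstep
          exact ⟨t, rfl, .single ⟨i, hi, ht i (Finset.mem_singleton_self i)⟩⟩
        | tail _ hstep ih =>
          obtain ⟨i, hi, hstep⟩ := hstep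
          obtain ⟨u, rfl, hu⟩ := ih
          obtain ⟨t, rfl, ht⟩ := h.exists_step u _ _ hstep
          exact ⟨t, rfl, hu.tail ⟨i, hi, ht i (Finset.mem_singleton_self i)⟩⟩
      obtain ⟨t, rfl, ht⟩ := hlift
      exact hφ (hsat t ht)
    · intro hm t ht
      -- The induction along the path needs `⊔_I φ` as well as `φ`.
      have key : φ ∈ π t ∧ union I φ ∈ π t := by
        induction ht with
        | single hst =>
          obtain ⟨i, hi, hst⟩ := hst
          exact h.union_mem I i φ _ _ (hs.2 φ.self_mem_subformulas) hs.1 hi hst hm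
        | tail _ hst ih =>
          obtain ⟨i, hi, hst⟩ := hst
          exact h.union_mem I i φ _ _ (hs.2 φ.self_mem_subformulas) hs.1 hi hst ih.2
      exact key.1

/-- A formula valid for `L` belongs to every label, provided the relations satisfy the frame
condition of `L`. -/
theorem mem_of_valid {φ : Form P A} (hφ : Valid L φ) {S : Type u} {R : A → S → S → Prop}
    {π : S → MCS P A L} (h : IsLabelling φ.subformulas R π) (hR : ∀ i, L.FrameCond (R i))
    (s : S) : φ ∈ π s := by
  let M : Model P A :=
    { S := S, nonempty := ⟨s⟩, R := R, V := fun p => {s | Form.var p ∈ π s} }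
  exact (sat_iff (M := M) φ.finite_subformulas h (fun _ _ => Iff.rfl) φ subset_rfl s).1
    (hφ M hR s)

end IsLabelling

/-! ### One-step models, for the logics without transitivity -/

section OneStep

variable (F : Set (Form P A))

/-- Points are maximal consistent sets tagged by a set of indices; a filtered `J`-step toggles
membership of `J` in the tag, so that `J` can be read off from the tags of its two ends. -/
def OneStepRel (i : A) (s t : MCS P A L × Set (Index A)) : Prop :=
  (L.IsRefl ∧ s = t) ∨ ∃ J : Index A, i ∈ J.1 ∧ symmDiff s.2 t.2 = {J} ∧ Step F J s.1 t.1

variable {F}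

/-- The tags of the two ends determine `J`, so all `i ∈ I` are served by the same step. A toggle
never leaves the tag unchanged, so it cannot coexist with equality of the points. -/
lemma OneStepRel.eq_or_exists {I : Index A} {s t : MCS P A L × Set (Index A)}
    (h : ∀ i ∈ I.1, OneStepRel F i s t) :
    (L.IsRefl ∧ s = t) ∨ ∃ J : Index A, I.1 ⊆ J.1 ∧ Step F J s.1 t.1 := by
  obtain ⟨i₀, hi₀⟩ := I.2
  rcases h i₀ hi₀ with h₀ | ⟨J, -, hJ, hstep⟩
  · exact .inl h₀
  refine .inr ⟨J, fun i hi => ?_, hstep⟩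
  rcases h i hi with ⟨-, rfl⟩ | ⟨J', hiJ, hJ', -⟩
  · simp at hJ
  · rwa [Set.singleton_injective (hJ.symm.trans hJ')]

lemma OneStepRel.exists_of_step (s : MCS P A L × Set (Index A)) {J : Index A} {Δ : MCS P A L}
    (h : Step F J s.1 Δ) : ∃ t : MCS P A L × Set (Index A), t.1 = Δ ∧
      ∀ i ∈ J.1, OneStepRel F i s t :=
  ⟨(Δ, symmDiff s.2 {J}), rfl, fun _ hi => .inr ⟨J, hi, symmDiff_symmDiff_cancel_left _ _, h⟩⟩

lemma oneStep_isLabelling :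
    IsLabelling F (OneStepRel (L := L) F) (Prod.fst : MCS P A L × Set (Index A) → _) where
  inter_mem I φ s t hφ hI h hm := by
    rcases OneStepRel.eq_or_exists h with ⟨hL, rfl⟩ | ⟨J, hIJ, hstep⟩
    · exact inter_refl hL hm
    · exact hstep.mem hI hφ (fun _ => inter_mono hIJ) hm
  box_mem i φ s t hφ hI h hm := by
    rcases h with ⟨hL, rfl⟩ | ⟨J, hi, -, hstep⟩
    · exact inter_refl hL (MCS.box_mem.1 hm)
    · exact hstep.mem hI hφ (fun _ => inter_of_box hi) hm
  union_mem I i φ s t hφ hI hi h hm := by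
    rcases h with ⟨hL, rfl⟩ | ⟨J, hiJ, -, hstep⟩
    · exact ⟨inter_refl hL (inter_of_union hi (J := I) hi hm).1, hm⟩
    · exact ⟨hstep.mem hI hφ (fun _ h => (inter_of_union hi hiJ h).1) hm,
        hstep.mem hI hI (fun _ h => (inter_of_union hi hiJ h).2) hm⟩
  exists_step s _ _ h := OneStepRel.exists_of_step s h

lemma OneStepRel.refl (hL : L.IsRefl) (i : A) (s : MCS P A L × Set (Index A)) :
    OneStepRel F i s s :=
  .inl ⟨hL, rfl⟩

lemma OneStepRel.symm (hL : L.IsSymm) {i : A} {s t : MCS P A L × Set (Index A)}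
    (h : OneStepRel F i s t) : OneStepRel F i t s := by
  rcases h with ⟨hL, rfl⟩ | ⟨J, hi, hJ, hstep⟩
  · exact .inl ⟨hL, rfl⟩
  · exact .inr ⟨J, hi, by rwa [symmDiff_comm], hstep.symm hL⟩

/-- Axiom D forbids `□_i φ₀` and `□_i ¬φ₀` together; some `□_i`-formula is thus missing, which
forces a canonical successor. -/
lemma OneStepRel.serial (φ₀ : Form P A) (hL : L = .D) (i : A) (s : MCS P A L × Set (Index A)) :
    ∃ t, OneStepRel F i s t := by
  obtain ⟨φ, hφ⟩ : ∃ φ, box i φ ∉ s.1 := by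
    by_contra! hn
    exact mem_neg.1 (mem_of_provable_imp (.boxD i φ₀ hL) (hn φ₀)) (hn _)
  obtain ⟨Δ, hΔ, -⟩ := exists_canon (fun hm => hφ (MCS.box_mem.2 hm))
  obtain ⟨t, -, ht⟩ := OneStepRel.exists_of_step (F := F) s hΔ.step
  exact ⟨t, ht i (Finset.mem_singleton_self i)⟩

lemma oneStep_frameCond (φ₀ : Form P A) (hL : ¬ L.IsTrans) (i : A) :
    L.FrameCond (OneStepRel (P := P) (L := L) F i) := by
  cases L with
  | K => trivial
  | D => exact OneStepRel.serial φ₀ rfl i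
  | T => exact OneStepRel.refl (by simp [Logic.IsRefl]) i
  | B => exact ⟨OneStepRel.refl (by simp [Logic.IsRefl]) i,
      fun _ _ => OneStepRel.symm (by simp [Logic.IsSymm])⟩
  | S4 => exact absurd (.inl rfl) hL
  | S5 => exact absurd (.inr rfl) hL

end OneStep

/-! ### Flow models, for the transitive logics -/

section Flow

/-- The increments `h Δ - h Γ` of a potential `h` along the edges `(J, Γ, Δ)`, extended to
integer flows. -/
noncomputable def flowIncrement (h : MCS P A L → ℤ) :
    (Index A × MCS P A L × MCS P A L →₀ ℤ) →ₗ[ℤ] ℤ :=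
  Finsupp.linearCombination ℤ fun e => h e.2.2 - h e.2.1

variable (F : Set (Form P A))

/-- Points are maximal consistent sets together with an integer flow on labelled edges. Two points
are related by `i` if the difference of the flows is a flow from the first to the second
maximal consistent set through filtered steps with label containing `i`. -/
def FlowRel (i : A) (s t : MCS P A L × (Index A × MCS P A L × MCS P A L →₀ ℤ)) : Prop :=
  (∀ e, (t.2 - s.2) e ≠ 0 → i ∈ e.1.1 ∧ Step F e.1 e.2.1 e.2.2) ∧
  (¬ L.IsSymm → ∀ e, 0 ≤ (t.2 - s.2) e) ∧
  ∀ h : MCS P A L → ℤ, flowIncrement h (t.2 - s.2) = h t.1 - h s.1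

variable {F}

lemma FlowRel.refl (i : A) (s : MCS P A L × (Index A × MCS P A L × MCS P A L →₀ ℤ)) :
    FlowRel F i s s := by
  simp [FlowRel]

lemma FlowRel.symm (hL : L.IsSymm) {i : A}
    {s t : MCS P A L × (Index A × MCS P A L × MCS P A L →₀ ℤ)} (h : FlowRel F i s t) :
    FlowRel F i t s := by
  have hneg : s.2 - t.2 = -(t.2 - s.2) := (neg_sub _ _).symm
  refine ⟨fun e he => h.1 e fun h0 => he ?_, fun hn => absurd hL hn, fun g => ?_⟩
  · rw [hneg, Finsupp.neg_apply, h0, neg_zero]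
  · rw [hneg, map_neg, h.2.2, neg_sub]

lemma FlowRel.trans {i : A} {s t u : MCS P A L × (Index A × MCS P A L × MCS P A L →₀ ℤ)}
    (h : FlowRel F i s t) (h' : FlowRel F i t u) : FlowRel F i s u := by
  have hadd : u.2 - s.2 = (u.2 - t.2) + (t.2 - s.2) := (sub_add_sub_cancel _ _ _).symm
  refine ⟨fun e he => ?_, fun hn e => ?_, fun g => ?_⟩
  · by_cases h0 : (t.2 - s.2) e = 0
    · refine h'.1 e fun h1 => he ?_
      rw [hadd, Finsupp.add_apply, h0, h1, add_zero]
    · exact h.1 e h0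
  · rw [hadd, Finsupp.add_apply]
    exact add_nonneg (h'.2.1 hn e) (h.2.1 hn e)
  · rw [hadd, map_add, h.2.2, h'.2.2, sub_add_sub_cancel]

/-- A formula preserved by all filtered `J`-steps with `I ⊆ J` is preserved by the intersection of
the relations of the members of `I`. -/
lemma FlowRel.mem_of_mem {I : Index A} {φ : Form P A} (hφ : φ ∈ F)
    (hp : ∀ J : Index A, I.1 ⊆ J.1 → ∀ Θ : MCS P A L, φ ∈ Θ → inter J φ ∈ Θ)
    {s t : MCS P A L × (Index A × MCS P A L × MCS P A L →₀ ℤ)}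
    (h : ∀ i ∈ I.1, FlowRel F i s t) (hs : φ ∈ s.1) : φ ∈ t.1 := by
  classical
  obtain ⟨i₀, hi₀⟩ := I.2
  by_contra ht
  -- With the indicator of `φ` as potential, losing `φ` between `s` and `t` would make the total
  -- increment `-1`.
  have hval := (h i₀ hi₀).2.2 fun Γ => if φ ∈ Γ then 1 else 0
  have hnonneg : 0 ≤ flowIncrement (fun Γ : MCS P A L => if φ ∈ Γ then 1 else 0) (t.2 - s.2) := by
    rw [flowIncrement, Finsupp.linearCombination_apply, Finsupp.sum]
    refine Finset.sum_nonneg fun e he => ?_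
    have hne := Finsupp.mem_support_iff.1 he
    have hIe : I.1 ⊆ e.1.1 := fun i hi => ((h i hi).1 e hne).1
    have hstep := ((h i₀ hi₀).1 e hne).2
    have hfwd : φ ∈ e.2.1 → φ ∈ e.2.2 := hstep.mem hφ hφ (hp _ hIe)
    -- In the symmetric case the flow may be negative, but `φ` is preserved both ways along each
    -- edge, so every increment vanishes.
    by_cases hL : L.IsSymm
    · have hbwd : φ ∈ e.2.2 → φ ∈ e.2.1 := (hstep.symm hL).mem hφ hφ (hp _ hIe)
      simp [show φ ∈ e.2.1 ↔ φ ∈ e.2.2 from ⟨hfwd, hbwd⟩]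
    · refine smul_nonneg ((h i₀ hi₀).2.1 hL e) ?_
      by_cases h1 : φ ∈ e.2.1
      · simp [h1, hfwd h1]
      · by_cases h2 : φ ∈ e.2.2 <;> simp [h1, h2]
  simp only [hs, ht, if_true, if_false] at hval
  lia

lemma FlowRel.exists_of_step (s : MCS P A L × (Index A × MCS P A L × MCS P A L →₀ ℤ))
    {J : Index A} {Δ : MCS P A L} (h : Step F J s.1 Δ) :
    ∃ t : MCS P A L × (Index A × MCS P A L × MCS P A L →₀ ℤ), t.1 = Δ ∧
      ∀ i ∈ J.1, FlowRel F i s t := by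
  classical
  -- Send one unit of flow along the edge realizing the step.
  refine ⟨(Δ, s.2 + Finsupp.single (J, s.1, Δ) 1), rfl, fun i hi => ?_⟩
  simp only [FlowRel, add_sub_cancel_left]
  refine ⟨fun e he => ?_, fun _ e => ?_, fun g => ?_⟩
  · obtain rfl : (J, s.1, Δ) = e := by
      by_contra hne
      exact he (Finsupp.single_eq_of_ne' hne)
    exact ⟨hi, h⟩
  · rw [Finsupp.single_apply]
    split_ifs <;> simp
  · simp [flowIncrement]

/-- A link may combine many steps, so the modal formula itself is transported, by axiom 4 or (⊔1),
and unpacked by reflexivity only at the target. -/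
lemma flow_isLabelling (hL : L.IsTrans) : IsLabelling F (FlowRel (L := L) F)
    (Prod.fst : MCS P A L × (Index A × MCS P A L × MCS P A L →₀ ℤ) → _) := by
  have hrefl : L.IsRefl := .inr (.inr hL)
  refine ⟨fun I φ s t _ hI h hm => ?_, fun i φ s t _ hI h hm => ?_,
    fun I i φ s t _ hI hi h hm => ?_, fun s _ _ h => FlowRel.exists_of_step s h⟩
  · exact inter_refl hrefl
      (FlowRel.mem_of_mem hI (fun J hJ _ hm => inter_mono hJ (inter_trans hL hm)) h hm)
  · refine inter_refl hrefl (MCS.box_mem.1 (FlowRel.mem_of_mem (I := Index.single i) hI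
      (fun J hJ _ hm => inter_mono hJ (inter_imp (provable_imp fun _ => MCS.box_mem.2)
        (inter_trans hL (MCS.box_mem.1 hm)))) ?_ hm))
    simpa [Index.single] using h
  · have hmem : union I φ ∈ t.1 := FlowRel.mem_of_mem (I := Index.single i) hI
      (fun J hJ _ hm => (inter_of_union hi (hJ (Finset.mem_singleton_self i)) hm).2)
      (by simpa [Index.single] using h) hm
    exact ⟨inter_refl hrefl (inter_of_union hi (J := I) hi hmem).1, hmem⟩

lemma flow_frameCond (hL : L.IsTrans) (i : A) :
    L.FrameCond (FlowRel (P := P) (L := L) F i) := by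
  rcases hL with rfl | rfl
  · exact ⟨FlowRel.refl i, fun _ _ _ => FlowRel.trans⟩
  · exact ⟨FlowRel.refl i, FlowRel.symm (.inr rfl), FlowRel.trans⟩

end Flow

end ModalIU

theorem mainTheorem2 {P A : Type u} [Countable P] [Infinite P] [Countable A]
    (L : ModalIU.Logic) (φ : ModalIU.Form P A) (hφ : ModalIU.Valid L φ) :
    ModalIU.Provable L φ := by
  refine ModalIU.MCS.provable_of_forall_mem fun Γ => ?_
  by_cases hL : L.IsTrans
  · exact (ModalIU.flow_isLabelling hL).mem_of_valid hφ (ModalIU.flow_frameCond hL) (Γ, 0)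
  · exact ModalIU.oneStep_isLabelling.mem_of_valid hφ (ModalIU.oneStep_frameCond φ hL) (Γ, ∅)
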